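/- Let $N=n+d$ with $n,d\ge 0$. A *formal generic submanifold* $M$ of codimension $d$ (and CR dimension $n$) through $0\in\mathbb C^N$ is given by $\rho=(\rho_1,\dots,\rho_d)\in\mathbb C[\![Z,\zeta]\!]^d$, $Z=(Z_1,\dots,Z_N)$, $\zeta=(\zeta_1,\dots,\zeta_N)$, with $\rho(0)=0$, $\rho(Z,\zeta)=\bar\rho(\zeta,Z)$ and $\partial_Z\rho_1(0)\wedge\dots\wedge\partial_Z\rho_d(0)\ne 0$ (a bar over a series means conjugation of its coefficients). *Normal coordinates* $(z,w)\in\mathbb C^n\times\mathbb C^d$ for $M$ at $0$ are given by a formal invertible change of coordinates $Z=Z(z,w)$, $Z(0)=0$, such that $$\rho(Z(z,w),\bar Z(\chi,\tau))=a(z,w,\chi,\tau)\,\bigl(w-Q(z,\chi,\tau)\bigr),$$ where $a$ is an invertible $d\times d$ matrix of formal power series and $Q\in\mathbb C[\![z,\chi,\tau]\!]^d$ satisfies $Q(0,\chi,\tau)=Q(z,0,\tau)=\tau$. Write $Q^j(z,\chi,0)=\sum_\alpha q^j_\alpha(\chi)z^\alpha$, $j=1,\dots,d$. $M$ is *essentially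 finite* at $0$ if the ideal of $\mathbb C[\![\chi]\!]$ generated by all the $q^j_\alpha$ has finite codimension. Let $M,\widetilde M$ be formal generic submanifolds of the same codimension $d$ through $0\in\mathbb C^N$, with defining series $\rho,\tilde\rho$, and let $H\colon(\mathbb C^N,0)\to(\mathbb C^N,0)$ be a formal holomorphic mapping (i.e. $H\in\mathbb C[\![Z]\!]^N$, $H(0)=0$) sending $M$ into $\widetilde M$, i.e. $\tilde\rho(H(Z),\bar H(\zeta))=c(Z,\zeta)\rho(Z,\zeta)$ for some $d\times d$ matrix $c$ of formal power series. In normal coordinates $(\tilde z,\tilde w)$ for $\widetilde M$ write $H=(F,G)$ with $F$ having $n$ and $G=(G_1,\dots,G_d)$ having $d$ components. $H$ is *transversally regular* to $\widetilde M$ at $0$ if the ring $\mathbb C[\![Z]\!]/(G_1(Z),\dots,G_d(Z))$ has Krull dimension $n=N-d$. $H$ is *Segre finite* if, $F$ being written in normal coordinates $(z,w)$ for $M$, the mapping $z\mapsto F(z,0)$ is finite, i.e. the ideal generated by the components of $F(z,0)$ has finite codimension in $\mathbb C[\![z]\!]$. **Theorem.** If $M$ is essentially finite at $0$ (in some normal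 coordinates for $M$) and $H$ is transversally regular to $\widetilde M$ at $0$ (in some normal coordinates for $\widetilde M$), then $H$ is Segre finite (in every choice of normal coordinates for $M$ and $\widetilde M$). -/

import Mathlib

noncomputable section

namespace FormalCR

/-- A tuple of formal power series `f = (f_i)_{i : τ}` in the variables indexed by `σ`, viewed as a
formal mapping `ℂ^σ → ℂ^τ`. It maps `0` to `0` when `FixesZero f` holds. -/
abbrev FormalTuple (σ τ : Type) : Type := τ → MvPowerSeries σ ℂ

/-- No component has a constant term, i.e. `f : (ℂ^σ, 0) → (ℂ^τ, 0)`. -/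
def FixesZero {σ τ : Type} (f : FormalTuple σ τ) : Prop :=
  ∀ i, MvPowerSeries.constantCoeff (f i) = 0

/-- The composition `f ∘ g` of formal mappings (used only when `g` maps `0` to `0`). -/
def compose {σ τ υ : Type} (f : FormalTuple τ υ) (g : FormalTuple σ τ) : FormalTuple σ υ :=
  fun i => MvPowerSeries.subst g (f i)

/-- The identity mapping. -/
def idTuple (σ : Type) : FormalTuple σ σ := fun i => MvPowerSeries.X i

/-- The mapping whose components are the coordinate functions `x_{e i}`. -/
def coords {σ τ : Type} (e : τ → σ) : FormalTuple σ τ := fun i => MvPowerSeries.X (e i)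

/-- `f ↦ f̄`: every coefficient is replaced by its complex conjugate. -/
def conj {σ τ : Type} (f : FormalTuple σ τ) : FormalTuple σ τ :=
  fun i => MvPowerSeries.map (starRingEnd ℂ) (f i)

/-- The mapping `(x, y) ↦ (f(x), f̄(y))` on the doubled variables. -/
def complexify {σ τ : Type} (f : FormalTuple σ τ) : FormalTuple (σ ⊕ σ) (τ ⊕ τ) :=
  Sum.elim (compose f (coords Sum.inl)) (compose (conj f) (coords Sum.inr))

/-- The ideal `I(f)` generated by the components of `f`. -/
def compIdeal {σ τ : Type} (f : FormalTuple σ τ) : Ideal (MvPowerSeries σ ℂ) :=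
  Ideal.span (Set.range f)

/-- An ideal of finite codimension: `dim_ℂ ℂ[[x]] / I < ∞`. -/
def FiniteCodim {σ : Type} (I : Ideal (MvPowerSeries σ ℂ)) : Prop :=
  Module.Finite ℂ (MvPowerSeries σ ℂ ⧸ I)

/-- A finite formal mapping. -/
def IsFiniteMap {σ τ : Type} (f : FormalTuple σ τ) : Prop :=
  FiniteCodim (compIdeal f)

/-- A formal generic submanifold of codimension `d` (and CR dimension `n`) through `0` in `ℂ^N`,
`N = n + d`, given by its defining series `ρ(Z, ζ)`. The variables `Z` are indexed by `Sum.inl`,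
the variables `ζ` by `Sum.inr`. -/
structure GenericSubmanifold (n d : ℕ) where
  /-- the defining series `ρ(Z, ζ)` -/
  rho : FormalTuple (Fin (n + d) ⊕ Fin (n + d)) (Fin d)
  /-- `ρ(0) = 0` -/
  rho_zero : FixesZero rho
  /-- the reality condition `ρ(Z, ζ) = ρ̄(ζ, Z)` -/
  reality : rho = compose (conj rho) (coords Sum.swap)
  /-- `∂_Z ρ_1(0) ∧ … ∧ ∂_Z ρ_d(0) ≠ 0` -/
  generic : LinearIndependent ℂ
    (fun (j : Fin d) (k : Fin (n + d)) =>
      MvPowerSeries.coeff (Finsupp.single (Sum.inl k) 1) (rho j))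

/-- `H(M) ⊂ M'`: there is a `d × d` matrix `c(Z, ζ)` of formal power series with
`ρ'(H(Z), H̄(ζ)) = c(Z, ζ) ρ(Z, ζ)`. -/
def MapsInto {n d : ℕ} (H : FormalTuple (Fin (n + d)) (Fin (n + d)))
    (M M' : GenericSubmanifold n d) : Prop :=
  ∃ c : Matrix (Fin d) (Fin d) (MvPowerSeries (Fin (n + d) ⊕ Fin (n + d)) ℂ),
    compose M'.rho (complexify H) = c.mulVec M.rho

/-- Normal coordinates `(z, w)` for `M` at `0`: a formal invertible change of coordinates
`Z = Z(z, w)` (with inverse `Z ↦ (z(Z), w(Z))`) and a series `Q(z, χ, τ)` such that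
`ρ(Z(z, w), Z̄(χ, τ)) = a(z, w, χ, τ) (w - Q(z, χ, τ))` with `a` an invertible matrix of power series,
and `Q(0, χ, τ) = Q(z, 0, τ) = τ`. -/
structure NormalCoordinates {n d : ℕ} (M : GenericSubmanifold n d) where
  /-- the change of coordinates `Z = Z(z, w)` -/
  chart : FormalTuple (Fin n ⊕ Fin d) (Fin (n + d))
  /-- its inverse `Z ↦ (z(Z), w(Z))` -/
  inv : FormalTuple (Fin (n + d)) (Fin n ⊕ Fin d)
  chart_zero : FixesZero chart
  inv_zero : FixesZero inv
  chart_inv : compose chart inv = idTuple (Fin (n + d))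
  inv_chart : compose inv chart = idTuple (Fin n ⊕ Fin d)
  /-- the series `Q(z, χ, τ)` -/
  Q : FormalTuple (Fin n ⊕ (Fin n ⊕ Fin d)) (Fin d)
  /-- the matrix `a(z, w, χ, τ)` -/
  a : Matrix (Fin d) (Fin d) (MvPowerSeries ((Fin n ⊕ Fin d) ⊕ (Fin n ⊕ Fin d)) ℂ)
  a_isUnit : IsUnit a
  /-- `ρ(Z(z, w), Z̄(χ, τ)) = a(z, w, χ, τ) (w - Q(z, χ, τ))` -/
  equation : compose M.rho (complexify chart) =
    a.mulVec (coords (fun j => Sum.inl (Sum.inr j)) -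
      compose Q (coords (Sum.map Sum.inl id)))
  /-- `Q(0, χ, τ) = τ` -/
  Q_left : compose Q (Sum.elim (fun _ => 0) (coords id)) =
    (coords Sum.inr : FormalTuple (Fin n ⊕ Fin d) (Fin d))
  /-- `Q(z, 0, τ) = τ` -/
  Q_mid : compose Q (Sum.elim (coords Sum.inl) (Sum.elim (fun _ => 0) (coords Sum.inr))) =
    (coords Sum.inr : FormalTuple (Fin n ⊕ Fin d) (Fin d))

/-- The coefficient `q^j_α(χ)` of `z^α` in `Q^j(z, χ, 0) = ∑_α q^j_α(χ) z^α`. -/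
def NormalCoordinates.q {n d : ℕ} {M : GenericSubmanifold n d} (x : NormalCoordinates M)
    (j : Fin d) (α : Fin n →₀ ℕ) : MvPowerSeries (Fin n) ℂ :=
  fun β => MvPowerSeries.coeff (Finsupp.sumElim α (Finsupp.sumElim β 0)) (x.Q j)

/-- The essential ideal of `M` at `0`, computed in the normal coordinates `x`: the ideal of `ℂ[[χ]]`
generated by all `q^j_α(χ)`. -/
def NormalCoordinates.essentialIdeal {n d : ℕ} {M : GenericSubmanifold n d}
    (x : NormalCoordinates M) : Ideal (MvPowerSeries (Fin n) ℂ) :=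
  Ideal.span (Set.range (fun p : Fin d × (Fin n →₀ ℕ) => x.q p.1 p.2))

/-- `M` is essentially finite at `0`. The condition does not depend on the normal coordinates;
as a hypothesis it is required in one system of normal coordinates only. -/
def EssentiallyFinite {n d : ℕ} (M : GenericSubmanifold n d) : Prop :=
  ∃ x : NormalCoordinates M, FiniteCodim x.essentialIdeal

/-- The component `F` of `H = (F, G)` in the normal coordinates `y = (z̃, w̃)` of the target. -/
def NormalCoordinates.compF {n d : ℕ} {M' : GenericSubmanifold n d} (y : NormalCoordinates M')
    (H : FormalTuple (Fin (n + d)) (Fin (n + d))) : FormalTuple (Fin (n + d)) (Fin n) :=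
  compose (fun i => y.inv (Sum.inl i)) H

/-- The component `G` of `H = (F, G)` in the normal coordinates `y = (z̃, w̃)` of the target. -/
def NormalCoordinates.compG {n d : ℕ} {M' : GenericSubmanifold n d} (y : NormalCoordinates M')
    (H : FormalTuple (Fin (n + d)) (Fin (n + d))) : FormalTuple (Fin (n + d)) (Fin d) :=
  compose (fun j => y.inv (Sum.inr j)) H

/-- `H` is transversally regular to `M'` at `0`: the ring `ℂ[[Z]] / I(G(Z))` has Krull dimension
`n = N - d`. The condition does not depend on the normal coordinates for `M'`; as a hypothesis it is
required in one system of normal coordinates only. -/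
def TransversallyRegular {n d : ℕ} (H : FormalTuple (Fin (n + d)) (Fin (n + d)))
    (M' : GenericSubmanifold n d) : Prop :=
  ∃ y : NormalCoordinates M',
    ringKrullDim (MvPowerSeries (Fin (n + d)) ℂ ⧸ compIdeal (y.compG H)) = (n : WithBot ℕ∞)

/-- The first Segre mapping `v¹(t) = (t, 0)`, in normal coordinates `(z, w)`. -/
def segreOne (n d : ℕ) : FormalTuple (Fin n) (Fin n ⊕ Fin d) :=
  Sum.elim (idTuple (Fin n)) (fun _ => 0)

/-- `H` is Segre finite (as a mapping from `M` to `M'`): `F ∘ v¹ : (ℂⁿ, 0) → (ℂⁿ, 0)` is a finite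
formal mapping, where `F` is written in normal coordinates for `M` and `M'`. The condition does not
depend on the normal coordinates; it is asserted here for all of them. -/
def SegreFinite {n d : ℕ} (H : FormalTuple (Fin (n + d)) (Fin (n + d)))
    (M M' : GenericSubmanifold n d) : Prop :=
  ∀ (x : NormalCoordinates M) (y : NormalCoordinates M'),
    IsFiniteMap (compose (compose (y.compF H) x.chart) (segreOne n d))

end FormalCR

end

/-! Argue by contradiction. If the ideal of `F(z, 0)` has infinite codimension, some prime `P` of
`ℂ[[z]]` contains it and misses a variable (`exists_prime_X_notMem`); geometrically, `F(z, 0)`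
vanishes on a positive-dimensional germ. On the first Segre set `ρ'(H, 0) = 0`, which forces `G = 0`
there, so all of `H(Z(z, 0))` dies in the domain `R = ℂ[[z]]/P`. `exists_change_coordinates` carries
this over to the coordinates in which `M` is essentially finite, as a homomorphism `θ` to `R`.

Now look at the second Segre set, the points `Z(z, Q(z, χ, 0))` paired with `Z̄(χ, 0)`. Restricting
`χ` to the conjugate germ gives a homomorphism `Φ : ℂ[[Z]] → R[[z]]`. There `H̄(Z̄(χ, 0))` vanishes,
so `ρ'(H, 0)` is killed (`fiberHom_rho`) and `I(G) ⊆ ker Φ`. Setting `χ = 0` shows that `ker Φ` lies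
in the kernel of restriction to `Z(z, 0)` (`subst_segreOne_of_fiberHom`), whose quotient is
`ℂ[[z]]`. The inclusion is strict: by essential finiteness some coefficient `q^j_α` survives on the
germ, so some `w_j` is not in `ker Φ` (`exists_fiberHom_inv_ne_zero`). As `ker Φ` is prime,
`ℂ[[Z]]/I(G)` has dimension at least `n + 1`, against transversal regularity.

The homomorphisms are purely algebraic, with no continuity; `map_subst_congr` is what makes them
compatible with substitution. -/

noncomputable section

namespace MvPowerSeries

/-! ### Ideals of finite codimension and dimension of power series rings -/

/-- If every monomial of `f` is divisible by some `X i ^ k` with `i ∈ s`, then `f` lies in the ideal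
generated by these powers. -/
theorem mem_span_X_pow {σ R : Type*} [CommRing R] (k : ℕ) (s : Finset σ) (f : MvPowerSeries σ R)
    (hf : ∀ d, coeff d f ≠ 0 → ∃ i ∈ s, k ≤ d i) :
    f ∈ Ideal.span ((fun i => (X i : MvPowerSeries σ R) ^ k) '' (s : Set σ)) := by
  classical
  induction s using Finset.induction_on generalizing f with
  | empty =>
    have : f = 0 := by
      ext d
      by_contra h
      simpa using hf d h
    simp [this]
  | insert i s _ ih =>
    let g : MvPowerSeries σ R := fun d => if k ≤ d i then coeff d f else 0
    have hg : ∀ d, coeff d g = if k ≤ d i then coeff d f else 0 := fun d => rfl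
    have h1 : (X i : MvPowerSeries σ R) ^ k ∣ g := by
      rw [X_pow_dvd_iff]
      intro m hm
      rw [hg, if_neg (by omega)]
    have h2 := ih (f - g) (by
      intro d hd
      rw [map_sub, hg] at hd
      split_ifs at hd with hk
      · simp at hd
      · obtain ⟨j, hj, hjk⟩ := hf d (by simpa using hd)
        rcases Finset.mem_insert.1 hj with rfl | hj
        · exact absurd hjk hk
        · exact ⟨j, hj, hjk⟩)
    rw [← sub_add_cancel f g]
    refine add_mem (Ideal.span_mono (Set.image_mono (by simp)) h2) ?_
    exact Ideal.mem_of_dvd _ h1 (Ideal.subset_span ⟨i, by simp, rfl⟩)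

/-- An ideal containing a power of each variable has finite codimension. -/
theorem finite_quotient_of_X_pow_mem {σ K : Type*} [Finite σ] [Field K]
    (I : Ideal (MvPowerSeries σ K)) (hI : ∀ i, ∃ k, (X i : MvPowerSeries σ K) ^ k ∈ I) :
    Module.Finite K (MvPowerSeries σ K ⧸ I) := by
  classical
  cases nonempty_fintype σ
  choose m hm using hI
  obtain ⟨k, hk⟩ : ∃ k, ∀ i, m i ≤ k := ⟨∑ i, m i, fun i =>
    Finset.single_le_sum (f := m) (fun _ _ => Nat.zero_le _) (Finset.mem_univ i)⟩
  let b : σ →₀ ℕ := Finsupp.equivFunOnFinite.symm fun _ => k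
  refine ⟨⟨(Finset.Iic b).image fun d => Ideal.Quotient.mk I (monomial d 1), ?_⟩⟩
  rw [eq_top_iff]
  rintro q -
  obtain ⟨f, rfl⟩ := Ideal.Quotient.mk_surjective q
  -- Outside the box `d ≤ b` some exponent exceeds `k`, so truncating to the box changes `f` only by
  -- an element of the ideal of the `k`-th powers.
  have key : f - ∑ d ∈ Finset.Iic b, coeff d f • monomial d (1 : K) ∈ I := by
    have hle : Ideal.span ((fun i => (X i : MvPowerSeries σ K) ^ k) ''
        ((Finset.univ : Finset σ) : Set σ)) ≤ I := by
      rw [Ideal.span_le]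
      rintro _ ⟨i, -, rfl⟩
      exact I.pow_mem_of_pow_mem (hm i) (hk i)
    refine hle (mem_span_X_pow k _ _ fun d hd => ?_)
    by_contra hcon
    simp only [Finset.mem_univ, true_and, not_exists, not_le] at hcon
    apply hd
    have hdb : d ∈ Finset.Iic b := Finset.mem_Iic.2 fun i => (hcon i).le
    rw [map_sub, map_sum, Finset.sum_eq_single d]
    · simp
    · intro e _ he
      simp [coeff_monomial_ne he.symm]
    · exact fun h => absurd hdb h
  rw [Ideal.Quotient.eq.2 key, map_sum]
  refine Submodule.sum_mem _ fun d hd => ?_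
  have : Ideal.Quotient.mk I (coeff d f • monomial d (1 : K)) =
      coeff d f • Ideal.Quotient.mk I (monomial d (1 : K)) := rfl
  rw [this]
  exact Submodule.smul_mem _ _ (Submodule.subset_span (by
    simpa using ⟨d, by simpa using hd, rfl⟩))

/-- An ideal of infinite codimension is contained in a prime ideal missing some variable. -/
theorem exists_prime_X_notMem {σ K : Type*} [Finite σ] [Field K] (I : Ideal (MvPowerSeries σ K))
    (hI : ¬ Module.Finite K (MvPowerSeries σ K ⧸ I)) :
    ∃ P : Ideal (MvPowerSeries σ K), P.IsPrime ∧ I ≤ P ∧ ∃ i, (X i : MvPowerSeries σ K) ∉ P := by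
  have : ∃ i, ∀ k, (X i : MvPowerSeries σ K) ^ k ∉ I := by
    by_contra! h
    exact hI (finite_quotient_of_X_pow_mem I h)
  obtain ⟨i, hi⟩ := this
  have hrad : (X i : MvPowerSeries σ K) ∉ I.radical := fun ⟨k, hk⟩ => hi k hk
  rw [Ideal.radical_eq_sInf, Submodule.mem_sInf] at hrad
  push Not at hrad
  obtain ⟨P, ⟨hIP, hP⟩, hX⟩ := hrad
  exact ⟨P, hP, hIP, i, hX⟩

/-- A homomorphism to a domain that vanishes on an ideal of finite codimension kills every
variable. -/
theorem map_X_eq_zero_of_finite_quotient {σ K R : Type*} [Field K] [CommRing R]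
    [IsDomain R] (φ : MvPowerSeries σ K →+* R) (I : Ideal (MvPowerSeries σ K))
    (hI : Module.Finite K (MvPowerSeries σ K ⧸ I)) (hle : I ≤ RingHom.ker φ) (i : σ) :
    φ (X i) = 0 := by
  have : Module.Finite K (MvPowerSeries σ K ⧸ RingHom.ker φ) :=
    Module.Finite.of_surjective (Ideal.Quotient.factorₐ K hle).toLinearMap
      (Ideal.Quotient.factor_surjective hle)
  have hp : (RingHom.ker φ).IsPrime := RingHom.ker_isPrime φ
  -- A domain finite over a field is a field; the kernel is therefore the maximal ideal of the local
  -- ring, which contains every variable.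
  have hf : IsField (MvPowerSeries σ K ⧸ RingHom.ker φ) :=
    isField_of_isIntegral_of_isField' (Field.toIsField K)
  have hmax := Ideal.Quotient.maximal_of_isField _ hf
  have := IsLocalRing.eq_maximalIdeal hmax
  rw [← RingHom.mem_ker, this, IsLocalRing.mem_maximalIdeal, mem_nonunits_iff,
    isUnit_iff_constantCoeff]
  simp

/-- Adjoining one power series variable raises the dimension by at least one; only this lower bound
is needed. -/
theorem le_ringKrullDim (K : Type*) [Field K] (n : ℕ) :
    (n : WithBot ℕ∞) ≤ ringKrullDim (MvPowerSeries (Fin n) K) := by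
  induction n with
  | zero => simpa using ringKrullDim_nonneg_of_nontrivial
  | succ n ih =>
    rw [ringKrullDim_eq_of_ringEquiv (finSuccEquiv K n).toRingEquiv]
    refine le_trans ?_ ringKrullDim_succ_le_ringKrullDim_powerseries
    push_cast
    gcongr

/-! ### Iterated power series and substitution -/

/-- A power series in the variables `σ ⊕ τ`, viewed as a power series in the variables `σ` whose
coefficients are power series in the variables `τ`. -/
def curryFun {σ τ R : Type*} [CommRing R] (f : MvPowerSeries (σ ⊕ τ) R) :
    MvPowerSeries σ (MvPowerSeries τ R) :=
  fun α => (fun β => coeff (Finsupp.sumElim α β) f : MvPowerSeries τ R)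

theorem coeff_coeff_curryFun {σ τ R : Type*} [CommRing R] (f : MvPowerSeries (σ ⊕ τ) R)
    (α : σ →₀ ℕ) (β : τ →₀ ℕ) :
    coeff β (coeff α (curryFun f)) = coeff (Finsupp.sumElim α β) f := rfl

/-- `curryFun` as a ring homomorphism. -/
def curry (σ τ R : Type*) [CommRing R] :
    MvPowerSeries (σ ⊕ τ) R →+* MvPowerSeries σ (MvPowerSeries τ R) where
  toFun := curryFun
  map_zero' := rfl
  map_add' _ _ := rfl
  map_one' := by
    classical
    ext α β
    rw [coeff_coeff_curryFun, coeff_one, coeff_one]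
    by_cases hα : α = 0
    · by_cases hβ : β = 0
      · simp [hα, hβ]
      · rw [if_neg, if_pos hα, coeff_one, if_neg hβ]
        intro h
        apply hβ
        ext i
        simpa using DFunLike.congr_fun h (Sum.inr i)
    · rw [if_neg, if_neg hα, map_zero]
      intro h
      apply hα
      ext i
      simpa using DFunLike.congr_fun h (Sum.inl i)
  map_mul' f g := by
    classical
    ext α β
    rw [coeff_coeff_curryFun, coeff_mul, coeff_mul, map_sum]
    simp_rw [coeff_mul, coeff_coeff_curryFun]
    rw [← Finset.sum_product']
    refine Finset.sum_bij'
      (fun p _ => (((Finsupp.sumFinsuppEquivProdFinsupp p.1).1,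
        (Finsupp.sumFinsuppEquivProdFinsupp p.2).1),
        ((Finsupp.sumFinsuppEquivProdFinsupp p.1).2, (Finsupp.sumFinsuppEquivProdFinsupp p.2).2)))
      (fun p _ => (Finsupp.sumElim p.1.1 p.2.1, Finsupp.sumElim p.1.2 p.2.2)) ?_ ?_ ?_ ?_ ?_
    · rintro ⟨a, b⟩ h
      replace h : a + b = Finsupp.sumElim α β := Finset.HasAntidiagonal.mem_antidiagonal.1 h
      refine Finset.mem_product.2 ⟨Finset.HasAntidiagonal.mem_antidiagonal.2 ?_,
        Finset.HasAntidiagonal.mem_antidiagonal.2 ?_⟩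
      · ext i
        simpa using DFunLike.congr_fun h (Sum.inl i)
      · ext i
        simpa using DFunLike.congr_fun h (Sum.inr i)
    · rintro ⟨⟨a, b⟩, c, d⟩ h
      have h1 : a + b = α := Finset.HasAntidiagonal.mem_antidiagonal.1 (Finset.mem_product.1 h).1
      have h2 : c + d = β := Finset.HasAntidiagonal.mem_antidiagonal.1 (Finset.mem_product.1 h).2
      refine Finset.HasAntidiagonal.mem_antidiagonal.2 ?_
      rw [← Finsupp.sumElim_add, h1, h2]
    · rintro ⟨a, b⟩ _
      simp
    · rintro ⟨⟨a, b⟩, c, d⟩ _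
      simp
    · rintro ⟨a, b⟩ _
      simp

theorem coeff_coeff_curry {σ τ R : Type*} [CommRing R] (f : MvPowerSeries (σ ⊕ τ) R) (α : σ →₀ ℕ)
    (β : τ →₀ ℕ) : coeff β (coeff α (curry σ τ R f)) = coeff (Finsupp.sumElim α β) f := rfl

theorem curry_rename_inr {σ τ R : Type*} [CommRing R] (f : MvPowerSeries τ R) :
    curry σ τ R (rename (Function.Embedding.inr : τ ↪ σ ⊕ τ) f) = C f := by
  classical
  ext α β
  rw [coeff_coeff_curry, coeff_C]
  split_ifs with h
  · rw [h, ← Finsupp.embDomain_inr, coeff_embDomain_rename]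
  · rw [map_zero]
    apply coeff_rename_eq_zero
    rintro ⟨x, hx⟩
    apply h
    ext i
    have := DFunLike.congr_fun hx (Sum.inl i)
    rw [Finsupp.mapDomain_of_notMem_range _ _ (by simp)] at this
    simpa using this.symm

/-- Setting the variables outside of the range of `e` equal to zero. -/
theorem subst_eq_killCompl {σ τ R : Type*} [CommRing R] [Finite τ] (e : σ ↪ τ)
    {a : τ → MvPowerSeries σ R} (he : ∀ i, a (e i) = X i) (ha : ∀ t ∉ Set.range e, a t = 0)
    (f : MvPowerSeries τ R) : subst a f = killCompl e f := by
  classical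
  have hmon : ∀ d : τ →₀ ℕ, (d.prod fun s k => a s ^ k) = killCompl e (monomial d (1 : R)) := by
    intro d
    rw [← mul_one (1 : R), ← smul_eq_mul, map_smul, one_smul, monomial_one_eq, Finsupp.prod,
      Finsupp.prod, map_prod]
    refine Finset.prod_congr rfl fun s _ => ?_
    rw [map_pow]
    congr 1
    by_cases hs : s ∈ Set.range e
    · obtain ⟨i, rfl⟩ := hs
      rw [he, killCompl_X]
    · rw [ha s hs, killCompl_X_eq_zero hs]
  have hsub : HasSubst a := hasSubst_of_constantCoeff_zero fun t => by
    by_cases hs : t ∈ Set.range e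
    · obtain ⟨i, rfl⟩ := hs
      rw [he, constantCoeff_X]
    · rw [ha t hs, map_zero]
  ext n
  rw [coeff_subst hsub, coeff_killCompl, finsum_eq_single _ (Finsupp.embDomain e n)]
  · rw [hmon, killCompl_monomial_embDomain, coeff_monomial_same, smul_eq_mul, mul_one]
  · intro d hd
    rw [hmon, coeff_killCompl, coeff_monomial_ne hd.symm, smul_zero]

/-- If `φ` identifies the components of two substitutions, it identifies their results. -/
theorem map_subst_congr {σ τ R S : Type*} [CommRing R] [CommRing S] [Finite σ]
    (φ : MvPowerSeries τ R →+* S) {a b : σ → MvPowerSeries τ R}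
    (ha : ∀ i, constantCoeff (a i) = 0) (hb : ∀ i, constantCoeff (b i) = 0)
    (h : ∀ i, φ (a i) = φ (b i)) (f : MvPowerSeries σ R) : φ (subst a f) = φ (subst b f) := by
  cases nonempty_fintype σ
  -- Universal case: in doubled variables `(x, y)`, `f(x + y) - f(x)` vanishes at `y = 0`, hence
  -- lies in the ideal of the `y_i`. Here `k` sets `y = 0`, and `m` specializes to `x = b`, `y = a -
  -- b`, turning this into a finite combination of the `a_i - b_i`, each killed by `φ`.
  let s : σ → MvPowerSeries (σ ⊕ σ) R := fun i => X (Sum.inl i) + X (Sum.inr i)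
  let l : σ → MvPowerSeries (σ ⊕ σ) R := fun i => X (Sum.inl i)
  let k : σ ⊕ σ → MvPowerSeries σ R := Sum.elim X 0
  let m : σ ⊕ σ → MvPowerSeries τ R := Sum.elim b (a - b)
  have hs : HasSubst s := hasSubst_of_constantCoeff_zero fun i => by simp [s]
  have hl : HasSubst l := hasSubst_of_constantCoeff_zero fun i => by simp [l]
  have hk : HasSubst k := hasSubst_of_constantCoeff_zero fun i => by rcases i with i | i <;> simp [k]
  have hm : HasSubst m := hasSubst_of_constantCoeff_zero fun i => by
    rcases i with i | i <;> simp [m, ha, hb]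
  have hkill : killCompl Function.Embedding.inl (subst s f - subst l f) = 0 := by
    rw [← subst_eq_killCompl (a := k) Function.Embedding.inl (fun i => by simp [k])
      (by rintro (i | i) hi <;> simp [k] at hi ⊢), subst_sub hk, subst_comp_subst_apply hs hk,
      subst_comp_subst_apply hl hk, sub_eq_zero]
    congr 1
    funext i
    simp only [s, l]
    rw [subst_add hk, subst_X hk, subst_X hk]
    simp [k]
  have hmem := mem_span_X_pow 1 (Finset.univ.map Function.Embedding.inr) (subst s f - subst l f)
    (by
      intro d hd
      by_contra! hcon
      apply hd
      have : d = Finsupp.embDomain Function.Embedding.inl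
          (Finsupp.comapDomain Sum.inl d Sum.inl_injective.injOn) := by
        ext (i | i)
        · simp
        · simpa using hcon (Sum.inr i) (by simp)
      rw [this, ← coeff_killCompl, hkill, map_zero])
  have hker : Ideal.span ((fun i => (X i : MvPowerSeries (σ ⊕ σ) R) ^ 1) ''
      ((Finset.univ.map (Function.Embedding.inr : σ ↪ σ ⊕ σ) : Finset (σ ⊕ σ)) : Set (σ ⊕ σ))) ≤
      RingHom.ker (φ.comp (substAlgHom (R := R) hm).toRingHom) := by
    rw [Ideal.span_le]
    rintro _ ⟨_, hi, rfl⟩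
    obtain ⟨i, -, rfl⟩ := by simpa using hi
    change φ (substAlgHom hm (X (Sum.inr i) ^ 1)) = 0
    rw [pow_one, substAlgHom_X]
    simp [m, h]
  have : φ (substAlgHom hm (subst s f - subst l f)) = 0 := hker hmem
  rw [substAlgHom_apply, subst_sub hm, subst_comp_subst_apply hs hm, subst_comp_subst_apply hl hm,
    map_sub,
    sub_eq_zero] at this
  convert! this using 3
  · funext i
    rw [subst_add hm, subst_X hm, subst_X hm]
    simp [m]
  · funext i
    rw [subst_X hm]
    simp [m]

end MvPowerSeries

namespace FormalCR

open MvPowerSeries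

/-! ### Calculus of composition of formal mappings -/

theorem FixesZero.hasSubst {σ τ : Type} [Finite τ] {f : FormalTuple σ τ} (hf : FixesZero f) :
    HasSubst f :=
  hasSubst_of_constantCoeff_zero hf

theorem fixesZero_zero (σ τ : Type) : FixesZero (0 : FormalTuple σ τ) := fun _ => map_zero _

theorem fixesZero_coords {σ τ : Type} (e : τ → σ) : FixesZero (coords e) :=
  fun _ => constantCoeff_X _

theorem fixesZero_idTuple (σ : Type) : FixesZero (idTuple σ) := fun _ => constantCoeff_X _

theorem FixesZero.sumElim {σ τ υ : Type} {f : FormalTuple σ τ} {g : FormalTuple σ υ}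
    (hf : FixesZero f) (hg : FixesZero g) : FixesZero (Sum.elim f g : FormalTuple σ (τ ⊕ υ)) :=
  Sum.rec hf hg

theorem FixesZero.compose {σ τ υ : Type} [Finite τ] {f : FormalTuple τ υ} {g : FormalTuple σ τ}
    (hf : FixesZero f) (hg : FixesZero g) : FixesZero (compose f g) :=
  fun i => constantCoeff_subst_eq_zero hg.hasSubst hg (hf i)

theorem FixesZero.conj {σ τ : Type} {f : FormalTuple σ τ} (hf : FixesZero f) :
    FixesZero (conj f) := fun i => by
  rw [FormalCR.conj, constantCoeff_map, hf i, map_zero]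

theorem fixesZero_segreOne (n d : ℕ) : FixesZero (segreOne n d) :=
  (fixesZero_idTuple _).sumElim fun _ => map_zero _

theorem compose_assoc {σ τ υ ω : Type} [Finite τ] [Finite υ] (f : FormalTuple υ ω)
    {g : FormalTuple τ υ} {h : FormalTuple σ τ} (hg : FixesZero g) (hh : FixesZero h) :
    compose (compose f g) h = compose f (compose g h) :=
  funext fun i => subst_comp_subst_apply hg.hasSubst hh.hasSubst (f i)

theorem compose_idTuple {σ τ : Type} (f : FormalTuple σ τ) : compose f (idTuple σ) = f :=
  funext fun i => congr_fun subst_self (f i)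

theorem idTuple_compose {σ τ : Type} [Finite τ] {g : FormalTuple σ τ} (hg : FixesZero g) :
    compose (idTuple τ) g = g :=
  funext fun i => subst_X hg.hasSubst i

theorem coords_compose {σ τ υ : Type} [Finite τ] (e : υ → τ) {g : FormalTuple σ τ}
    (hg : FixesZero g) : compose (coords e) g = g ∘ e :=
  funext fun i => subst_X hg.hasSubst (e i)

theorem compose_sub {σ τ υ : Type} [Finite τ] (f f' : FormalTuple τ υ) {g : FormalTuple σ τ}
    (hg : FixesZero g) : compose (f - f') g = compose f g - compose f' g :=
  funext fun i => subst_sub hg.hasSubst (f i) (f' i)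

theorem compose_zero_left {σ τ υ : Type} [Finite τ] {g : FormalTuple σ τ} (hg : FixesZero g) :
    compose (0 : FormalTuple τ υ) g = 0 :=
  funext fun _ => by
    rw [compose, ← substAlgHom_apply (R := ℂ) hg.hasSubst, Pi.zero_apply, map_zero, Pi.zero_apply]

theorem compose_zero_right {σ τ υ : Type} {f : FormalTuple τ υ} (hf : FixesZero f) :
    compose f (0 : FormalTuple σ τ) = 0 :=
  funext fun i => subst_zero_of_constantCoeff_zero (hf i)

theorem compose_sumElim_left {σ τ υ ω : Type} (f : FormalTuple τ υ) (f' : FormalTuple τ ω)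
    (g : FormalTuple σ τ) : compose (Sum.elim f f') g = Sum.elim (compose f g) (compose f' g) := by
  funext i
  rcases i with i | i <;> rfl

theorem compose_mulVec {σ τ υ ω : Type} [Finite τ] [Fintype υ]
    (a : Matrix ω υ (MvPowerSeries τ ℂ)) (v : FormalTuple τ υ) {g : FormalTuple σ τ}
    (hg : FixesZero g) :
    compose (a.mulVec v) g = (a.map (subst g)).mulVec (compose v g) := by
  funext i
  simp only [compose, Matrix.mulVec, dotProduct, Matrix.map_apply,
    ← substAlgHom_apply (R := ℂ) hg.hasSubst, map_sum, map_mul]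

theorem complexify_compose {σ τ υ : Type} [Finite τ] (f : FormalTuple τ υ) {A B : FormalTuple σ τ}
    (hA : FixesZero A) (hB : FixesZero B) :
    compose (complexify f) (Sum.elim A B) = Sum.elim (compose f A) (compose (conj f) B) := by
  rw [complexify, compose_sumElim_left, compose_assoc _ (fixesZero_coords _) (hA.sumElim hB),
    compose_assoc _ (fixesZero_coords _) (hA.sumElim hB), coords_compose _ (hA.sumElim hB),
    coords_compose _ (hA.sumElim hB), Sum.elim_comp_inl, Sum.elim_comp_inr]

theorem FixesZero.complexify {σ τ : Type} [Finite σ] {f : FormalTuple σ τ} (hf : FixesZero f) :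
    FixesZero (complexify f) :=
  (hf.compose (fixesZero_coords _)).sumElim (hf.conj.compose (fixesZero_coords _))

/-- The components of `v` lie in the ideal generated by those of `a v`, for `a` invertible. -/
theorem mem_span_mulVec {A ι : Type*} [CommRing A] [Fintype ι] [DecidableEq ι] {a : Matrix ι ι A}
    (ha : IsUnit a) (v : ι → A) (j : ι) : v j ∈ Ideal.span (Set.range (a.mulVec v)) := by
  obtain ⟨u, rfl⟩ := ha
  have : v j = ∑ i, (↑u⁻¹ : Matrix ι ι A) j i * ((u : Matrix ι ι A).mulVec v) i := by
    change _ = (↑u⁻¹ : Matrix ι ι A).mulVec ((u : Matrix ι ι A).mulVec v) j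
    rw [Matrix.mulVec_mulVec, Units.inv_mul, Matrix.one_mulVec]
  rw [this]
  exact sum_mem fun i _ => Ideal.mul_mem_left _ _ (Ideal.subset_span ⟨i, rfl⟩)

/-- The matrix `c` plays no role once `ρ` vanishes at `(A, B)`. Since `Z` and `ζ` are independent
variables, `B` need not be the conjugate of `A`. -/
theorem MapsInto.eval {n d : ℕ} {H : FormalTuple (Fin (n + d)) (Fin (n + d))}
    {M M' : GenericSubmanifold n d} (h : MapsInto H M M') (hH : FixesZero H) {σ : Type}
    {A B : FormalTuple σ (Fin (n + d))} (hA : FixesZero A) (hB : FixesZero B)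
    (hAB : compose M.rho (Sum.elim A B) = 0) :
    compose M'.rho (Sum.elim (compose H A) (compose (conj H) B)) = 0 := by
  obtain ⟨c, hc⟩ := h
  rw [← complexify_compose _ hA hB, ← compose_assoc _ hH.complexify (hA.sumElim hB), hc,
    compose_mulVec _ _ (hA.sumElim hB), hAB, Matrix.mulVec_zero]

/-! ### Normal coordinates and the first Segre mapping -/

namespace NormalCoordinates

variable {n d : ℕ} {M : GenericSubmanifold n d} (x : NormalCoordinates M) {σ : Type}

/-- The defining equation of normal coordinates at `(z, w) = U`, `(χ, τ) = V`. -/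
theorem equation_eval {U V : FormalTuple σ (Fin n ⊕ Fin d)} (hU : FixesZero U)
    (hV : FixesZero V) :
    compose M.rho (Sum.elim (compose x.chart U) (compose (conj x.chart) V)) =
      (x.a.map (subst (Sum.elim U V))).mulVec
        (U ∘ Sum.inr - compose x.Q (Sum.elim (U ∘ Sum.inl) V)) := by
  have hUV := hU.sumElim hV
  rw [← complexify_compose _ hU hV, ← compose_assoc _ x.chart_zero.complexify hUV, x.equation,
    compose_mulVec _ _ hUV, compose_sub _ _ hUV, coords_compose _ hUV,
    compose_assoc _ (fixesZero_coords _) hUV, coords_compose _ hUV]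
  have : Sum.elim U V ∘ Sum.map Sum.inl id = Sum.elim (U ∘ Sum.inl) V := by
    funext i
    rcases i with i | i <;> rfl
  rw [this]
  rfl

theorem a_map_isUnit {g : FormalTuple σ ((Fin n ⊕ Fin d) ⊕ (Fin n ⊕ Fin d))}
    (hg : FixesZero g) : IsUnit (x.a.map (subst g)) := by
  have := x.a_isUnit.map (RingHom.mapMatrix (m := Fin d)
    (substAlgHom (R := ℂ) hg.hasSubst).toRingHom)
  convert! this using 1
  refine Matrix.ext fun i j => ?_
  exact (substAlgHom_apply (R := ℂ) hg.hasSubst _).symm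

/-- `Q(z, 0, τ) = τ` at `z = u`, `τ = v`. -/
theorem Q_mid_eval {u : FormalTuple σ (Fin n)} {v : FormalTuple σ (Fin d)} (hu : FixesZero u)
    (hv : FixesZero v) : compose x.Q (Sum.elim u (Sum.elim 0 v)) = v := by
  have huv := hu.sumElim hv
  have := congr_arg (fun f => compose f (Sum.elim u v)) x.Q_mid
  simp only [coords_compose _ huv] at this
  have h0 : FixesZero (Sum.elim (coords Sum.inl) (Sum.elim (fun _ => 0) (coords Sum.inr)) :
      FormalTuple (Fin n ⊕ Fin d) (Fin n ⊕ (Fin n ⊕ Fin d))) :=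
    (fixesZero_coords _).sumElim ((fixesZero_zero _ _).sumElim (fixesZero_coords _))
  rw [compose_assoc _ h0 huv, compose_sumElim_left, compose_sumElim_left, coords_compose _ huv,
    coords_compose _ huv] at this
  rw [Sum.elim_comp_inl, Sum.elim_comp_inr] at this
  have hz : compose (fun _ => 0 : FormalTuple (Fin n ⊕ Fin d) (Fin n)) (Sum.elim u v) = 0 :=
    compose_zero_left huv
  rwa [hz] at this

theorem Q_zero_eval {u : FormalTuple σ (Fin n)} (hu : FixesZero u) :
    compose x.Q (Sum.elim u 0) = 0 := by
  have := x.Q_mid_eval hu (fixesZero_zero σ (Fin d))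
  have h0 : Sum.elim (0 : FormalTuple σ (Fin n)) (0 : FormalTuple σ (Fin d)) =
      (0 : FormalTuple σ (Fin n ⊕ Fin d)) := by
    funext i
    rcases i with i | i <;> rfl
  rwa [h0] at this

/-- `ρ(Z(z, 0), 0) = 0`. -/
theorem rho_segreOne :
    compose M.rho (Sum.elim (compose x.chart (segreOne n d)) 0) = 0 := by
  have := x.equation_eval (fixesZero_segreOne n d) (fixesZero_zero _ _)
  rw [compose_zero_right x.chart_zero.conj, x.Q_zero_eval] at this
  · rw [this, sub_zero]
    exact Matrix.mulVec_zero _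
  · exact fixesZero_idTuple _

/-- The components of `w(Z)` belong to the ideal generated by those of `ρ(Z, 0)`. -/
theorem inv_inr_mem (j : Fin d) :
    x.inv (Sum.inr j) ∈ compIdeal (compose M.rho (Sum.elim (idTuple (Fin (n + d))) 0)) := by
  -- With `(χ, τ) = 0` the term `Q` drops out, leaving `ρ(Z, 0) = a · w(Z)` with `a` invertible.
  have := x.equation_eval x.inv_zero (fixesZero_zero _ _)
  rw [compose_zero_right x.chart_zero.conj,
    x.Q_zero_eval (u := x.inv ∘ Sum.inl) (fun i => x.inv_zero _), x.chart_inv,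
    sub_zero] at this
  rw [compIdeal, this]
  exact mem_span_mulVec (x.a_map_isUnit
    (x.inv_zero.sumElim (fixesZero_zero _ _))) (x.inv ∘ Sum.inr) j

end NormalCoordinates

/-! ### Pullbacks, conjugation and vanishing under homomorphisms -/

theorem map_subst_eq_zero {σ τ S : Type} [CommRing S] [Finite σ] (φ : MvPowerSeries τ ℂ →+* S)
    {g : FormalTuple τ σ} (hg : FixesZero g) (h : ∀ i, φ (g i) = 0) {f : MvPowerSeries σ ℂ}
    (hf : constantCoeff f = 0) : φ (subst g f) = 0 := by
  rw [map_subst_congr φ hg (fixesZero_zero τ σ) (fun i => by rw [h, Pi.zero_apply, map_zero]) f]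
  exact (congr_arg φ (subst_zero_of_constantCoeff_zero hf)).trans (map_zero φ)

/-- Substitution of a formal mapping that fixes zero, as a ring homomorphism. -/
def FixesZero.pullback {σ τ : Type} [Finite τ] {g : FormalTuple σ τ} (hg : FixesZero g) :
    MvPowerSeries τ ℂ →+* MvPowerSeries σ ℂ :=
  (substAlgHom (R := ℂ) hg.hasSubst).toRingHom

theorem FixesZero.pullback_apply {σ τ : Type} [Finite τ] {g : FormalTuple σ τ} (hg : FixesZero g)
    (f : MvPowerSeries τ ℂ) : hg.pullback f = subst g f :=
  substAlgHom_apply (R := ℂ) hg.hasSubst f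

theorem conj_compose {σ τ υ : Type} [Finite τ] (f : FormalTuple τ υ) {g : FormalTuple σ τ}
    (hg : FixesZero g) : conj (compose f g) = compose (conj f) (conj g) :=
  funext fun i => map_subst hg.hasSubst (f i)

theorem conj_segreOne (n d : ℕ) : conj (segreOne n d) = segreOne n d := by
  funext i
  rcases i with i | i
  · exact map_X _ _
  · exact map_zero _

theorem map_conj_conj {σ : Type} (f : MvPowerSeries σ ℂ) :
    map (starRingEnd ℂ) (map (starRingEnd ℂ) f) = f := by
  ext d
  simp

theorem curry_subst_coords_inr {σ τ : Type} [Finite τ] (f : MvPowerSeries τ ℂ) :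
    curry σ τ ℂ (subst (coords Sum.inr : FormalTuple (σ ⊕ τ) τ) f) = C f := by
  rw [← curry_rename_inr, rename_eq_subst]
  rfl

theorem segreOne_compose {n d : ℕ} {σ : Type} {g : FormalTuple σ (Fin n)} (hg : FixesZero g) :
    compose (segreOne n d) g = Sum.elim g 0 := by
  rw [segreOne, compose_sumElim_left, idTuple_compose hg]
  congr 1
  exact compose_zero_left hg

/-- A homomorphism that kills the components of `ρ'(H(Z), 0)` kills those of `G(Z)`. -/
theorem NormalCoordinates.map_compG_eq_zero {n d : ℕ} {M' : GenericSubmanifold n d}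
    (y : NormalCoordinates M') {H : FormalTuple (Fin (n + d)) (Fin (n + d))} (hH : FixesZero H)
    {S : Type} [CommRing S] (φ : MvPowerSeries (Fin (n + d)) ℂ →+* S)
    (h : ∀ k, φ (compose M'.rho (Sum.elim H 0) k) = 0) (j : Fin d) :
    φ (y.compG H j) = 0 := by
  have hle : compIdeal (compose M'.rho (Sum.elim (idTuple (Fin (n + d))) 0)) ≤
      RingHom.ker (φ.comp hH.pullback) := by
    rw [compIdeal, Ideal.span_le]
    rintro _ ⟨k, rfl⟩
    change φ (hH.pullback _) = 0
    rw [hH.pullback_apply]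
    have := compose_assoc M'.rho ((fixesZero_idTuple (Fin (n + d))).sumElim
      (fixesZero_zero _ (Fin (n + d)))) hH
    rw [compose_sumElim_left, idTuple_compose hH, compose_zero_left hH] at this
    exact (congr_arg φ (congr_fun this k)).trans (h k)
  have : φ (hH.pullback (y.inv (Sum.inr j))) = 0 := hle (y.inv_inr_mem j)
  rwa [hH.pullback_apply] at this

/-! ### The second Segre mapping and the dimension estimate -/

namespace NormalCoordinates

variable {n d : ℕ} {M M' : GenericSubmanifold n d} (x : NormalCoordinates M)

theorem Q_fixesZero : FixesZero x.Q := fun j => by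
  have h := congr_fun (x.Q_zero_eval (fixesZero_zero (Fin n) (Fin n))) j
  have h0 : Sum.elim (0 : FormalTuple (Fin n) (Fin n)) (0 : FormalTuple (Fin n) (Fin n ⊕ Fin d)) =
      0 := by
    funext i
    rcases i with i | i <;> rfl
  rw [h0] at h
  have h1 := congr_arg constantCoeff
    ((subst_zero_eq_C_constantCoeff (τ := Fin n) (S := ℂ) (f := x.Q j)).symm.trans h)
  simpa using h1

/-- The series `Q(z, χ, 0)` in the variables `(z, χ)`. -/
def QZero : FormalTuple (Fin n ⊕ Fin n) (Fin d) :=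
  compose x.Q (Sum.elim (coords Sum.inl) (Sum.elim (coords Sum.inr) 0))

theorem QZero_fixesZero : FixesZero x.QZero :=
  x.Q_fixesZero.compose
    ((fixesZero_coords _).sumElim ((fixesZero_coords _).sumElim (fixesZero_zero _ _)))

theorem coeff_coeff_QZero (j : Fin d) (α : Fin n →₀ ℕ) :
    coeff α (curry (Fin n) (Fin n) ℂ (x.QZero j)) = x.q j α := by
  ext β
  let e : Fin n ⊕ Fin n ↪ Fin n ⊕ (Fin n ⊕ Fin d) :=
    (Function.Embedding.refl _).sumMap Function.Embedding.inl
  have he : x.QZero j = killCompl e (x.Q j) := by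
    refine subst_eq_killCompl e ?_ ?_ _
    · rintro (i | i) <;> rfl
    · rintro (i | i | i) hi
      · exact absurd ⟨Sum.inl i, rfl⟩ hi
      · exact absurd ⟨Sum.inr i, rfl⟩ hi
      · rfl
  rw [coeff_coeff_curry, he, coeff_killCompl]
  change _ = coeff (Finsupp.sumElim α (Finsupp.sumElim β 0)) (x.Q j)
  congr 1
  congr 1
  ext t
  rcases t with i | i | i
  · exact Finsupp.embDomain_apply_self e _ (Sum.inl i)
  · exact Finsupp.embDomain_apply_self e _ (Sum.inr i)
  · exact Finsupp.embDomain_of_notMem_range e _ _ (by rintro ⟨(k | k), hk⟩ <;> simp [e] at hk)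

/-- The mapping `(z, χ) ↦ (z, Q(z, χ, 0))`. -/
def segreTwo : FormalTuple (Fin n ⊕ Fin n) (Fin n ⊕ Fin d) :=
  Sum.elim (coords Sum.inl) x.QZero

theorem segreTwo_fixesZero : FixesZero x.segreTwo :=
  (fixesZero_coords _).sumElim x.QZero_fixesZero

/-- Setting `χ = 0` degenerates the second Segre mapping to the first, because `Q(z, 0, 0) = 0`. -/
theorem segreTwo_compose :
    compose x.segreTwo (Sum.elim (idTuple (Fin n)) 0) = segreOne n d := by
  have h : FixesZero (Sum.elim (idTuple (Fin n)) 0 : FormalTuple (Fin n) (Fin n ⊕ Fin n)) :=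
    (fixesZero_idTuple _).sumElim (fixesZero_zero _ _)
  rw [segreTwo, compose_sumElim_left, coords_compose _ h, QZero, compose_assoc _
    ((fixesZero_coords _).sumElim ((fixesZero_coords _).sumElim (fixesZero_zero _ _))) h,
    compose_sumElim_left, compose_sumElim_left, coords_compose _ h, coords_compose _ h,
    compose_zero_left h, Sum.elim_comp_inl, Sum.elim_comp_inr,
    x.Q_mid_eval (fixesZero_idTuple _) (fixesZero_zero _ _)]
  rfl

/-- `ρ(Z(z, Q(z, χ, 0)), Z̄(χ, 0)) = 0`. -/
theorem rho_segreTwo : compose M.rho (Sum.elim (compose x.chart x.segreTwo)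
    (compose (conj x.chart) (Sum.elim (coords Sum.inr) 0))) = 0 := by
  rw [x.equation_eval x.segreTwo_fixesZero ((fixesZero_coords _).sumElim (fixesZero_zero _ _))]
  have h0 : x.segreTwo ∘ Sum.inr - compose x.Q (Sum.elim (x.segreTwo ∘ Sum.inl)
      (Sum.elim (coords Sum.inr) 0)) = 0 := sub_self x.QZero
  rw [h0, Matrix.mulVec_zero]

/-- The ring homomorphism `ℂ[[z, χ]] → R[[z]]` induced by `f(χ) ↦ θ(f̄)`. -/
def fiberHom {R : Type} [CommRing R] (θ : MvPowerSeries (Fin n) ℂ →+* R) :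
    MvPowerSeries (Fin n ⊕ Fin n) ℂ →+* MvPowerSeries (Fin n) R :=
  (map (θ.comp (map (starRingEnd ℂ)))).comp (curry (Fin n) (Fin n) ℂ)

theorem coeff_fiberHom {R : Type} [CommRing R] (θ : MvPowerSeries (Fin n) ℂ →+* R)
    (f : MvPowerSeries (Fin n ⊕ Fin n) ℂ) (α : Fin n →₀ ℕ) : coeff α (fiberHom θ f) =
      θ (map (starRingEnd ℂ) (coeff α (curry (Fin n) (Fin n) ℂ f))) :=
  coeff_map _ _ _

/-- On the germ cut out by `θ` the second argument `H̄(Z̄(χ, 0))` of `ρ'` vanishes, so it may be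
replaced by `0` in the identity that holds on the second Segre set. -/
theorem fiberHom_rho {R : Type} [CommRing R] {H : FormalTuple (Fin (n + d)) (Fin (n + d))}
    (hH : FixesZero H) (hMM' : MapsInto H M M') (θ : MvPowerSeries (Fin n) ℂ →+* R)
    (hθ : ∀ i, θ (compose H (compose x.chart (segreOne n d)) i) = 0) (k : Fin d) :
    fiberHom θ (compose M'.rho
      (Sum.elim (compose H (compose x.chart x.segreTwo)) 0) k) = 0 := by
  have hV : FixesZero (Sum.elim (coords Sum.inr) 0 :
      FormalTuple (Fin n ⊕ Fin n) (Fin n ⊕ Fin d)) :=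
    (fixesZero_coords _).sumElim (fixesZero_zero _ _)
  have hA := x.chart_zero.compose x.segreTwo_fixesZero
  have hB := x.chart_zero.conj.compose hV
  have hz := hMM'.eval hH hA hB x.rho_segreTwo
  refine Eq.trans ?_ ((congr_arg (fiberHom θ) (congr_fun hz k)).trans (map_zero _))
  refine map_subst_congr _ ((hH.compose hA).sumElim (fixesZero_zero _ _))
    ((hH.compose hA).sumElim (hH.conj.compose hB)) ?_ _
  rintro (i | i)
  · rfl
  · have hs := fixesZero_segreOne n d
    have hc := x.chart_zero.compose hs
    have hcoord := fixesZero_coords (Sum.inr : Fin n → Fin n ⊕ Fin n)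
    -- The series `H̄(Z̄(χ, 0))` is the conjugate of `H(Z(z, 0))` with `z` renamed `χ`; `fiberHom`
    -- conjugates once more, so `θ` receives exactly the series it kills.
    have h1 : compose (conj H) (compose (conj x.chart) (Sum.elim (coords Sum.inr) 0)) =
        compose (conj (compose H (compose x.chart (segreOne n d))))
          (coords (Sum.inr : Fin n → Fin n ⊕ Fin n)) := by
      rw [conj_compose _ hc, conj_compose _ hs, conj_segreOne,
        compose_assoc _ (x.chart_zero.conj.compose hs) hcoord, compose_assoc _ hs hcoord,
        segreOne_compose hcoord]
    have h2 : fiberHom θ (compose (conj H) (compose (conj x.chart)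
        (Sum.elim (coords Sum.inr) 0)) i) = 0 := by
      rw [h1, compose, fiberHom, RingHom.comp_apply, curry_subst_coords_inr, map_C,
        RingHom.comp_apply, conj, map_conj_conj, hθ, map_zero]
    exact (map_zero _).trans h2.symm

/-- A ring homomorphism to a nontrivial ring kills no unit. Each `z`-coefficient, a series in `χ`
killed by `θ` after conjugation, therefore has zero constant term, which is its value at `χ = 0`. -/
theorem subst_segreOne_of_fiberHom {R : Type} [CommRing R] [Nontrivial R]
    (θ : MvPowerSeries (Fin n) ℂ →+* R) (f : MvPowerSeries (Fin (n + d)) ℂ)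
    (hf : fiberHom θ (subst (compose x.chart x.segreTwo) f) = 0) :
    subst (compose x.chart (segreOne n d)) f = 0 := by
  have hA := x.chart_zero.compose x.segreTwo_fixesZero
  have h0 : FixesZero (Sum.elim (idTuple (Fin n)) 0 : FormalTuple (Fin n) (Fin n ⊕ Fin n)) :=
    (fixesZero_idTuple _).sumElim (fixesZero_zero _ _)
  rw [← x.segreTwo_compose, ← compose_assoc _ x.segreTwo_fixesZero h0]
  change subst (fun i => subst _ _) f = 0
  rw [← subst_comp_subst_apply hA.hasSubst h0.hasSubst,
    subst_eq_killCompl Function.Embedding.inl (fun i => rfl)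
      (by rintro (i | i) hi <;> first | rfl | simp at hi)]
  ext α
  rw [coeff_killCompl, Finsupp.embDomain_inl, ← coeff_coeff_curry, map_zero]
  have h := congr_arg (coeff α) hf
  rw [coeff_fiberHom, map_zero] at h
  by_contra hne
  have hu := isUnit_iff_constantCoeff.2 (isUnit_iff_ne_zero.2 hne)
  exact ((hu.map (map (starRingEnd ℂ))).map θ).ne_zero h

/-- Along the second Segre mapping `w_j` becomes `Q^j(z, χ, 0)`, with `z`-coefficients `q^j_α(χ)`.
If all were killed after conjugation, the finite codimension of the essential ideal would force
every variable to be killed. -/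
theorem exists_fiberHom_inv_ne_zero {R : Type} [CommRing R] [IsDomain R]
    (hess : FiniteCodim x.essentialIdeal) (θ : MvPowerSeries (Fin n) ℂ →+* R)
    (hne : ∃ i, θ (X i) ≠ 0) :
    ∃ j, fiberHom θ (subst (compose x.chart x.segreTwo) (x.inv (Sum.inr j))) ≠ 0 := by
  by_contra! hcon
  obtain ⟨i, hi⟩ := hne
  apply hi
  have h := map_X_eq_zero_of_finite_quotient (θ.comp (map (starRingEnd ℂ))) x.essentialIdeal hess
    (by
      rw [essentialIdeal, Ideal.span_le]
      rintro _ ⟨⟨j, α⟩, rfl⟩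
      change θ (map (starRingEnd ℂ) (x.q j α)) = 0
      have h1 := congr_fun (compose_assoc x.inv x.chart_zero x.segreTwo_fixesZero) (Sum.inr j)
      rw [x.inv_chart, idTuple_compose x.segreTwo_fixesZero] at h1
      have h2 := hcon j
      change fiberHom θ (compose x.inv (compose x.chart x.segreTwo) (Sum.inr j)) = 0 at h2
      rw [← h1] at h2
      rw [← x.coeff_coeff_QZero, ← coeff_fiberHom]
      exact (congr_arg (coeff α) h2).trans (map_zero _)) i
  simpa using h

/-- If `H(Z(z, 0))` vanishes on a positive-dimensional formal subscheme of `ℂⁿ` and `M` is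
essentially finite, then the zero set of `G` has dimension larger than `n`. -/
theorem succ_le_ringKrullDim_quotient_compG {R : Type} [CommRing R] [IsDomain R]
    {H : FormalTuple (Fin (n + d)) (Fin (n + d))} (hH : FixesZero H) (hMM' : MapsInto H M M')
    (hess : FiniteCodim x.essentialIdeal) (y : NormalCoordinates M')
    (θ : MvPowerSeries (Fin n) ℂ →+* R)
    (hθ : ∀ i, θ (compose H (compose x.chart (segreOne n d)) i) = 0)
    (hne : ∃ i, θ (X i) ≠ 0) :
    (n : WithBot ℕ∞) + 1 ≤
      ringKrullDim (MvPowerSeries (Fin (n + d)) ℂ ⧸ compIdeal (y.compG H)) := by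
  have hA := x.chart_zero.compose x.segreTwo_fixesZero
  have hs := fixesZero_segreOne n d
  have hE := x.chart_zero.compose hs
  let Φ := (fiberHom θ).comp hA.pullback
  have hΦ : ∀ f, Φ f = fiberHom θ (subst (compose x.chart x.segreTwo) f) := fun f =>
    congr_arg (fiberHom θ) (hA.pullback_apply f)
  have hG : compIdeal (y.compG H) ≤ RingHom.ker Φ := by
    rw [compIdeal, Ideal.span_le]
    rintro _ ⟨j, rfl⟩
    refine y.map_compG_eq_zero hH Φ (fun k => ?_) j
    have h := compose_assoc M'.rho (hH.sumElim (fixesZero_zero _ (Fin (n + d)))) hA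
    rw [compose_sumElim_left, compose_zero_left hA] at h
    rw [hΦ]
    exact (congr_arg (fiberHom θ) (congr_fun h k)).trans (x.fiberHom_rho hH hMM' θ hθ k)
  have hker : ∀ f ∈ RingHom.ker Φ, hE.pullback f = 0 := fun f hf => by
    rw [hE.pullback_apply]
    exact x.subst_segreOne_of_fiberHom θ f ((hΦ f).symm.trans hf)
  have hinv : compose x.inv (compose x.chart (segreOne n d)) = segreOne n d := by
    rw [← compose_assoc _ x.chart_zero hs, x.inv_chart, idTuple_compose hs]
  -- The functions `z(Z)` restrict to the coordinates `z` on `Z(z, 0)`, which provides a section.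
  have hsurj : Function.Surjective hE.pullback := fun g => by
    have hi : FixesZero (x.inv ∘ Sum.inl) := fun i => x.inv_zero _
    refine ⟨subst (x.inv ∘ Sum.inl) g, ?_⟩
    rw [hE.pullback_apply, subst_comp_subst_apply hi.hasSubst hE.hasSubst]
    have : (fun i => subst (compose x.chart (segreOne n d)) ((x.inv ∘ Sum.inl) i)) =
        idTuple (Fin n) := funext fun i => congr_fun hinv (Sum.inl i)
    rw [this]
    exact congr_fun subst_self g
  obtain ⟨j, hj⟩ := x.exists_fiberHom_inv_ne_zero hess θ hne
  have : IsDomain (MvPowerSeries (Fin n) R) := NoZeroDivisors.to_isDomain _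
  have : (RingHom.ker Φ).IsPrime := RingHom.ker_isPrime Φ
  have hr : Ideal.Quotient.mk (RingHom.ker Φ) (x.inv (Sum.inr j)) ≠ 0 := by
    rw [Ne, Ideal.Quotient.eq_zero_iff_mem, RingHom.mem_ker, hΦ]
    exact hj
  -- The class of `w_j` is nonzero in the domain `ℂ[[Z]]/ker Φ` but restricts to zero on `Z(z, 0)`,
  -- so passing to `ℂ[[z]]` loses at least one dimension.
  have h1 := ringKrullDim_succ_le_of_surjective (Ideal.Quotient.lift _ hE.pullback hker)
    (Ideal.Quotient.lift_surjective_of_surjective _ _ hsurj) (mem_nonZeroDivisors_of_ne_zero hr)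
    (by
      rw [Ideal.Quotient.lift_mk, hE.pullback_apply]
      exact congr_fun hinv (Sum.inr j))
  have h2 := ringKrullDim_le_of_surjective (Ideal.Quotient.factor hG)
    (Ideal.Quotient.factor_surjective hG)
  refine le_trans ?_ (h1.trans h2)
  gcongr
  exact le_ringKrullDim ℂ n

end NormalCoordinates

/-! ### Independence of the normal coordinates and conclusion -/

/-- Vanishing of `F(Z(z, 0))`, in some normal coordinates, under a homomorphism entails vanishing of
`H(Z(z, 0))`. -/
theorem MapsInto.map_segreOne_eq_zero {n d : ℕ} {M M' : GenericSubmanifold n d}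
    {H : FormalTuple (Fin (n + d)) (Fin (n + d))} (hMM' : MapsInto H M M') (hH : FixesZero H)
    (x : NormalCoordinates M) (y : NormalCoordinates M') {R : Type} [CommRing R]
    (φ : MvPowerSeries (Fin n) ℂ →+* R)
    (hF : ∀ i, φ (compose (compose (y.compF H) x.chart) (segreOne n d) i) = 0)
    (i : Fin (n + d)) : φ (compose H (compose x.chart (segreOne n d)) i) = 0 := by
  have hs := fixesZero_segreOne n d
  have hE := x.chart_zero.compose hs
  have hz := hMM'.eval hH hE (fixesZero_zero _ _) x.rho_segreOne
  rw [compose_zero_right hH.conj] at hz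
  have hG : ∀ j, (φ.comp hE.pullback) (y.compG H j) = 0 :=
    y.map_compG_eq_zero hH _ fun k => by
      have h := compose_assoc M'.rho (hH.sumElim (fixesZero_zero _ (Fin (n + d)))) hE
      rw [compose_sumElim_left, compose_zero_left hE, hz] at h
      rw [RingHom.comp_apply, hE.pullback_apply]
      exact (congr_arg φ (congr_fun h k)).trans (map_zero φ)
  have hI := y.inv_zero.compose hH
  -- Both `F` and `G` are killed, and `H` is recovered from `(F, G)` by the target chart.
  have hall : ∀ t, (φ.comp hE.pullback) (compose y.inv H t) = 0 := by
    rintro (t | t)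
    · rw [RingHom.comp_apply, hE.pullback_apply]
      have := hF t
      rwa [compose_assoc _ x.chart_zero hs] at this
    · exact hG t
  have h := map_subst_eq_zero (φ.comp hE.pullback) hI hall (y.chart_zero i)
  rw [RingHom.comp_apply, hE.pullback_apply] at h
  have hc := compose_assoc y.chart y.inv_zero hH
  rw [y.chart_inv, idTuple_compose hH] at hc
  rw [hc]
  exact h

/-- Change of normal coordinates for `M`: a homomorphism killing the components of `H(Z(z, 0))`, but
not all the variables, yields one with the same properties in other normal coordinates. -/
theorem exists_change_coordinates {n d : ℕ} {M : GenericSubmanifold n d}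
    {H : FormalTuple (Fin (n + d)) (Fin (n + d))}
    (x x' : NormalCoordinates M) {R : Type} [CommRing R]
    (φ : MvPowerSeries (Fin n) ℂ →+* R)
    (hφ : ∀ i, φ (compose H (compose x'.chart (segreOne n d)) i) = 0)
    (hne : ∃ i, φ (X i) ≠ 0) :
    ∃ θ : MvPowerSeries (Fin n) ℂ →+* R,
      (∀ i, θ (compose H (compose x.chart (segreOne n d)) i) = 0) ∧ ∃ i, θ (X i) ≠ 0 := by
  have hs := fixesZero_segreOne n d
  have hE := x'.chart_zero.compose hs
  have hi : FixesZero (x.inv ∘ Sum.inl) := fun i => x.inv_zero _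
  let ψ := φ.comp hE.pullback
  have hw : ∀ j, ψ (x.inv (Sum.inr j)) = 0 := by
    have hle : compIdeal (compose M.rho (Sum.elim (idTuple (Fin (n + d))) 0)) ≤
        RingHom.ker ψ := by
      rw [compIdeal, Ideal.span_le]
      rintro _ ⟨k, rfl⟩
      have h := compose_assoc M.rho
        ((fixesZero_idTuple _).sumElim (fixesZero_zero _ (Fin (n + d)))) hE
      rw [compose_sumElim_left, compose_zero_left hE, idTuple_compose hE, x'.rho_segreOne] at h
      change φ (hE.pullback _) = 0
      rw [hE.pullback_apply]
      exact (congr_arg φ (congr_fun h k)).trans (map_zero φ)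
    exact fun j => hle (x.inv_inr_mem j)
  -- The witness evaluates a series at `z(Z)`, then applies `ψ`. As `ψ` kills `w(Z)`, it does not
  -- distinguish `Z(z(Z), 0)` from `Z(z(Z), w(Z)) = Z`.
  refine ⟨ψ.comp hi.pullback, fun i => ?_, ?_⟩
  · rw [RingHom.comp_apply, hi.pullback_apply]
    change ψ (compose (compose H (compose x.chart (segreOne n d))) (x.inv ∘ Sum.inl) i) = 0
    rw [compose_assoc _ (x.chart_zero.compose hs) hi, compose_assoc _ hs hi, segreOne_compose hi,
      ← compose_assoc _ x.chart_zero (hi.sumElim (fixesZero_zero _ _))]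
    refine (map_subst_congr ψ (hi.sumElim (fixesZero_zero _ _)) x.inv_zero ?_ _).trans ?_
    · rintro (j | j)
      · rfl
      · exact (map_zero ψ).trans (hw j).symm
    · change ψ (compose (compose H x.chart) x.inv i) = 0
      rw [compose_assoc _ x.chart_zero x.inv_zero, x.chart_inv, compose_idTuple]
      exact (congr_arg φ (hE.pullback_apply (H i))).trans (hφ i)
  -- If `ψ` killed all of `z(Z)` as well as `w(Z)`, it would kill every coordinate of `Z`, hence
  -- also the `z`-coordinates of `x'`, on which `ψ` gives the values `φ (X i)`.
  · by_contra! hcon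
    obtain ⟨i, hi0⟩ := hne
    apply hi0
    have hinv : ∀ t, ψ (x.inv t) = 0 := by
      rintro (t | t)
      · have h := hcon t
        rw [RingHom.comp_apply, hi.pullback_apply, subst_X hi.hasSubst] at h
        exact h
      · exact hw t
    have hX : ∀ k, ψ (X k) = 0 := fun k => by
      have h := map_subst_eq_zero ψ x.inv_zero hinv (x.chart_zero k)
      rwa [show subst x.inv (x.chart k) = X k from congr_fun x.chart_inv k] at h
    have h := map_subst_eq_zero ψ (fixesZero_idTuple _) hX (x'.inv_zero (Sum.inl i))
    have hx := congr_fun (compose_assoc x'.inv x'.chart_zero hs) (Sum.inl i)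
    rw [x'.inv_chart, idTuple_compose hs] at hx
    rw [show subst (idTuple _) (x'.inv (Sum.inl i)) = x'.inv (Sum.inl i) from
      congr_fun subst_self _, RingHom.comp_apply, hE.pullback_apply] at h
    exact (congr_arg φ hx).trans h

theorem segreFinite_of_transversallyRegular {n d : ℕ} {M M' : GenericSubmanifold n d}
    {H : FormalTuple (Fin (n + d)) (Fin (n + d))} (hH : FixesZero H) (hMM' : MapsInto H M M')
    (hM : EssentiallyFinite M) (hreg : TransversallyRegular H M') : SegreFinite H M M' := by
  obtain ⟨x, hx⟩ := hM
  obtain ⟨y, hy⟩ := hreg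
  intro x' y'
  by_contra hcon
  obtain ⟨P, hP, hle, hne⟩ := exists_prime_X_notMem _ hcon
  have hφ := hMM'.map_segreOne_eq_zero hH x' y' (Ideal.Quotient.mk P)
    fun i => Ideal.Quotient.eq_zero_iff_mem.2 (hle (Ideal.subset_span ⟨i, rfl⟩))
  obtain ⟨θ, hθ, hθne⟩ := exists_change_coordinates x x' (Ideal.Quotient.mk P) hφ
    (hne.imp fun i hi h => hi (Ideal.Quotient.eq_zero_iff_mem.1 h))
  have h := x.succ_le_ringKrullDim_quotient_compG hH hMM' hx y θ hθ hθne
  rw [hy] at h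
  exact absurd h (not_le.2 (by exact_mod_cast Nat.lt_succ_self n))

end FormalCR
end

theorem theorem6p4 {n d : ℕ} (M M' : FormalCR.GenericSubmanifold n d)
    (H : FormalCR.FormalTuple (Fin (n + d)) (Fin (n + d))) (hH : FormalCR.FixesZero H)
    (hMM' : FormalCR.MapsInto H M M') (hM : FormalCR.EssentiallyFinite M)
    (hreg : FormalCR.TransversallyRegular H M') :
    FormalCR.SegreFinite H M M' :=
  FormalCR.segreFinite_of_transversallyRegular hH hMM' hM hreg
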